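/- Let $\mathbf C$ be a (small) dagger symmetric monoidal category, strict or not: a symmetric monoidal category with an identity-on-objects involutive contravariant functor $(\cdot)^\dagger$ such that $(f\otimes g)^\dagger=f^\dagger\otimes g^\dagger$, $\sigma_{A,B}^\dagger=\sigma_{B,A}$, and the dagger of each associator and unitor is its inverse (this is automatic if $\mathbf C$ is strict). An isometry is a morphism $u$ with $u^\dagger\circ u=1$. Let $\mathbf C_{\mathrm{iso}}$ be the symmetric monoidal subcategory of $\mathbf C$ with all the objects and with the isometries as morphisms. Let $\mathbf C_{\mathrm{iso}}^{!}$ be its affine completion, the symmetric monoidal category with the same objects obtained from $\mathbf C_{\mathrm{iso}}$ by freely adding a morphism $!_A:A\to I$ for each object $A$, subject to $!_I=1_I$ and $!_B\circ h={!_A}$ for all $h:A\to B$ of $\mathbf C_{\mathrm{iso}}^{!}$, so that $I$ becomes terminal. Let $\mathbf C^{\mathrm{disc}}$ (the discard construction) be the identity-on-objects pushout of symmetric monoidal categories of $\mathbf C\leftarrow\mathbf C_{\mathrm{iso}}\to\mathbf C_{\mathrm{iso}}^{!}$. Explicitly, its objects are those of $\mathbf C$, and its morphisms are the formal composites and tensor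 products of morphisms of $\mathbf C$ and of $\mathbf C_{\mathrm{iso}}^{!}$, modulo the axioms of symmetric monoidal categories, the equations of both categories, and the identification of the two copies of each isometry. Let $\iota:\mathbf C\to\mathbf C^{\mathrm{disc}}$ be the canonical functor, and let $\delta_X:X\to I$ be the image of $!_X$ in $\mathbf C^{\mathrm{disc}}$. For morphisms $f:A\to B\otimes X$ and $g:A\to B\otimes Y$ of $\mathbf C$, write $f\sim_{\mathrm{iso}}g$ if there are an object $Z$ and isometries $u:X\to Z$ and $v:Y\to Z$ such that $(1_B\otimes u)\circ f=(1_B\otimes v)\circ g$, and let $\sim_{\mathrm{iso}}^{+}$ be the transitive closure of this relation (for fixed $A$ and $B$, on all pairs $(X,f)$ with $f:A\to B\otimes X$). **Lemma.** For all morphisms $f:A\to B\otimes X$ and $g:A\to B\otimes Y$ of $\mathbf C$, $$f\sim_{\mathrm{iso}}^{+}g\quad\Longleftrightarrow\quad(1_B\otimes\delta_X)\circ\iota(f)=(1_B\otimes\delta_Y)\circ\iota(g)\ \text{ in }\mathbf C^{\mathrm{disc}},$$ where $B\otimes I$ is identified with $B$. In particular, if $f$ and $g$ are purifications of the same morphism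 $h:A\to B$ of $\mathbf C^{\mathrm{disc}}$, that is, $h=(1_B\otimes\delta_X)\circ\iota(f)$ and $h=(1_B\otimes\delta_Y)\circ\iota(g)$, then $f\sim_{\mathrm{iso}}^{+}g$. -/

import Mathlib

open CategoryTheory MonoidalCategory

universe w v u

namespace DiscardConstruction

/-! ## Symmetric monoidal categories given by generators and relations

The objects, their tensor product and the unit are given. The morphisms are equivalence
classes of formal composites and tensor products of generating morphisms and of the structural
morphisms, modulo the axioms of symmetric monoidal categories and the given relations. -/

/-- A set of objects with a tensor product and a unit, and a set of generating morphisms. -/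
structure SMCSignature (O : Type u) where
  tens : O → O → O
  unit : O
  Gen : O → O → Type w

/-- Formal composites and tensor products of generators and structural morphisms. -/
inductive Term {O : Type u} (S : SMCSignature.{w} O) : O → O → Type (max u w)
  | gen {A B : O} (s : S.Gen A B) : Term S A B
  | one (A : O) : Term S A A
  | comp {A B D : O} (f : Term S A B) (g : Term S B D) : Term S A D
  | tensor {A A' B B' : O} (f : Term S A B) (g : Term S A' B') :
      Term S (S.tens A A') (S.tens B B')
  | assocHom (A B D : O) : Term S (S.tens (S.tens A B) D) (S.tens A (S.tens B D))
  | assocInv (A B D : O) : Term S (S.tens A (S.tens B D)) (S.tens (S.tens A B) D)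
  | leftHom (A : O) : Term S (S.tens S.unit A) A
  | leftInv (A : O) : Term S A (S.tens S.unit A)
  | rightHom (A : O) : Term S (S.tens A S.unit) A
  | rightInv (A : O) : Term S A (S.tens A S.unit)
  | braid (A B : O) : Term S (S.tens A B) (S.tens B A)

/-- A signature with a set of equations between parallel terms. -/
structure SMCPresentation (O : Type u) extends SMCSignature.{w} O where
  Rel : ∀ {A B : O}, Term toSMCSignature A B → Term toSMCSignature A B → Prop

open Term in
/-- The congruence generated by the axioms of symmetric monoidal categories and the given
equations. -/
inductive TermEquiv {O : Type u} (P : SMCPresentation.{w} O) :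
    ∀ {A B : O}, Term P.toSMCSignature A B → Term P.toSMCSignature A B → Prop
  | rel {A B} {s t : Term P.toSMCSignature A B} : P.Rel s t → TermEquiv P s t
  | refl {A B} (s : Term P.toSMCSignature A B) : TermEquiv P s s
  | symm {A B} {s t : Term P.toSMCSignature A B} : TermEquiv P s t → TermEquiv P t s
  | trans {A B} {r s t : Term P.toSMCSignature A B} :
      TermEquiv P r s → TermEquiv P s t → TermEquiv P r t
  | comp_congr {A B D} {s s' : Term P.toSMCSignature A B} {t t' : Term P.toSMCSignature B D} :
      TermEquiv P s s' → TermEquiv P t t' → TermEquiv P (comp s t) (comp s' t')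
  | tensor_congr {A A' B B'} {s s' : Term P.toSMCSignature A B}
      {t t' : Term P.toSMCSignature A' B'} :
      TermEquiv P s s' → TermEquiv P t t' → TermEquiv P (tensor s t) (tensor s' t')
  | id_comp {A B} (s : Term P.toSMCSignature A B) : TermEquiv P (comp (one A) s) s
  | comp_id {A B} (s : Term P.toSMCSignature A B) : TermEquiv P (comp s (one B)) s
  | assoc {A B D E} (r : Term P.toSMCSignature A B) (s : Term P.toSMCSignature B D)
      (t : Term P.toSMCSignature D E) :
      TermEquiv P (comp (comp r s) t) (comp r (comp s t))
  | tensor_id (A B : O) : TermEquiv P (tensor (one A) (one B)) (one (P.tens A B))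
  | tensor_comp {A B D A' B' D'} (s : Term P.toSMCSignature A B)
      (s' : Term P.toSMCSignature A' B') (t : Term P.toSMCSignature B D)
      (t' : Term P.toSMCSignature B' D') :
      TermEquiv P (comp (tensor s s') (tensor t t')) (tensor (comp s t) (comp s' t'))
  | assoc_hom_inv (A B D : O) :
      TermEquiv P (comp (assocHom A B D) (assocInv A B D)) (one _)
  | assoc_inv_hom (A B D : O) :
      TermEquiv P (comp (assocInv A B D) (assocHom A B D)) (one _)
  | assoc_naturality {A₁ A₂ A₃ B₁ B₂ B₃} (r : Term P.toSMCSignature A₁ B₁)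
      (s : Term P.toSMCSignature A₂ B₂) (t : Term P.toSMCSignature A₃ B₃) :
      TermEquiv P (comp (tensor (tensor r s) t) (assocHom B₁ B₂ B₃))
        (comp (assocHom A₁ A₂ A₃) (tensor r (tensor s t)))
  | left_hom_inv (A : O) : TermEquiv P (comp (leftHom A) (leftInv A)) (one _)
  | left_inv_hom (A : O) : TermEquiv P (comp (leftInv A) (leftHom A)) (one _)
  | left_naturality {A B} (s : Term P.toSMCSignature A B) :
      TermEquiv P (comp (tensor (one P.unit) s) (leftHom B)) (comp (leftHom A) s)
  | right_hom_inv (A : O) : TermEquiv P (comp (rightHom A) (rightInv A)) (one _)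
  | right_inv_hom (A : O) : TermEquiv P (comp (rightInv A) (rightHom A)) (one _)
  | right_naturality {A B} (s : Term P.toSMCSignature A B) :
      TermEquiv P (comp (tensor s (one P.unit)) (rightHom B)) (comp (rightHom A) s)
  | pentagon (A B D E : O) :
      TermEquiv P
        (comp (tensor (assocHom A B D) (one E))
          (comp (assocHom A (P.tens B D) E) (tensor (one A) (assocHom B D E))))
        (comp (assocHom (P.tens A B) D E) (assocHom A B (P.tens D E)))
  | triangle (A B : O) :
      TermEquiv P (comp (assocHom A P.unit B) (tensor (one A) (leftHom B)))
        (tensor (rightHom A) (one B))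
  | braid_naturality {A A' B B'} (s : Term P.toSMCSignature A B)
      (t : Term P.toSMCSignature A' B') :
      TermEquiv P (comp (tensor s t) (braid B B')) (comp (braid A A') (tensor t s))
  | hexagon (A B D : O) :
      TermEquiv P (comp (assocHom A B D) (comp (braid A (P.tens B D)) (assocHom B D A)))
        (comp (tensor (braid A B) (one D))
          (comp (assocHom B A D) (tensor (one B) (braid A D))))
  | symmetry (A B : O) : TermEquiv P (comp (braid A B) (braid B A)) (one _)

namespace SMCPresentation

/-- The objects of the symmetric monoidal category presented by `P`. -/
@[nolint unusedArguments]
structure Presented {O : Type u} (_P : SMCPresentation.{w} O) where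
  as : O

variable {O : Type u} (P : SMCPresentation.{w} O)

instance termSetoid (A B : O) : Setoid (Term P.toSMCSignature A B) :=
  ⟨TermEquiv P, ⟨.refl, .symm, .trans⟩⟩

namespace Presented

instance : Category.{max u w} P.Presented where
  Hom A B := Quotient (P.termSetoid A.as B.as)
  id A := Quotient.mk _ (Term.one A.as)
  comp := Quotient.map₂ Term.comp (fun _ _ hf _ _ hg ↦ TermEquiv.comp_congr hf hg)
  id_comp := by
    rintro A B ⟨f⟩
    exact Quotient.sound (.id_comp f)
  comp_id := by
    rintro A B ⟨f⟩
    exact Quotient.sound (.comp_id f)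
  assoc := by
    rintro A B D E ⟨f⟩ ⟨g⟩ ⟨h⟩
    exact Quotient.sound (.assoc f g h)

variable {P} in
/-- The morphism represented by a term. -/
def homMk {A B : O} (t : Term P.toSMCSignature A B) : (⟨A⟩ : P.Presented) ⟶ ⟨B⟩ :=
  Quotient.mk (P.termSetoid A B) t

instance : MonoidalCategoryStruct P.Presented where
  tensorObj A B := ⟨P.tens A.as B.as⟩
  tensorUnit := ⟨P.unit⟩
  tensorHom := Quotient.map₂ Term.tensor (fun _ _ hf _ _ hg ↦ TermEquiv.tensor_congr hf hg)
  whiskerLeft A _ _ := Quotient.map (Term.tensor (Term.one A.as))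
    (fun _ _ h ↦ TermEquiv.tensor_congr (.refl _) h)
  whiskerRight f B :=
    Quotient.map (fun t ↦ Term.tensor t (Term.one B.as))
      (fun _ _ h ↦ TermEquiv.tensor_congr h (.refl _)) f
  associator A B D := ⟨homMk (.assocHom A.as B.as D.as), homMk (.assocInv A.as B.as D.as),
    Quotient.sound (.assoc_hom_inv _ _ _), Quotient.sound (.assoc_inv_hom _ _ _)⟩
  leftUnitor A := ⟨homMk (.leftHom A.as), homMk (.leftInv A.as),
    Quotient.sound (.left_hom_inv _), Quotient.sound (.left_inv_hom _)⟩
  rightUnitor A := ⟨homMk (.rightHom A.as), homMk (.rightInv A.as),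
    Quotient.sound (.right_hom_inv _), Quotient.sound (.right_inv_hom _)⟩

instance : MonoidalCategory P.Presented :=
  MonoidalCategory.ofTensorHom
    (id_tensorHom_id := fun _ _ ↦ Quotient.sound (.tensor_id _ _))
    (id_tensorHom := by rintro A B D ⟨f⟩; rfl)
    (tensorHom_id := by rintro A B ⟨f⟩ D; rfl)
    (tensorHom_comp_tensorHom := by
      rintro _ _ _ _ _ _ ⟨f₁⟩ ⟨f₂⟩ ⟨g₁⟩ ⟨g₂⟩
      exact Quotient.sound (.tensor_comp _ _ _ _))
    (associator_naturality := by
      rintro _ _ _ _ _ _ ⟨f₁⟩ ⟨f₂⟩ ⟨f₃⟩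
      exact Quotient.sound (.assoc_naturality _ _ _))
    (leftUnitor_naturality := by
      rintro _ _ ⟨f⟩
      exact Quotient.sound (.left_naturality _))
    (rightUnitor_naturality := by
      rintro _ _ ⟨f⟩
      exact Quotient.sound (.right_naturality _))
    (pentagon := fun _ _ _ _ ↦ Quotient.sound (.pentagon _ _ _ _))
    (triangle := fun _ _ ↦ Quotient.sound (.triangle _ _))

theorem symmetry_aux (A B : P.Presented) :
    homMk (P := P) (.braid A.as B.as) ≫ homMk (.braid B.as A.as) = 𝟙 (A ⊗ B) :=
  Quotient.sound (.symmetry _ _)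

theorem hexagon_aux (A B D : P.Presented) :
    (α_ A B D).hom ≫ homMk (P := P) (.braid A.as (B ⊗ D).as) ≫ (α_ B D A).hom =
      homMk (P := P) (.braid A.as B.as) ▷ D ≫ (α_ B A D).hom ≫
        B ◁ homMk (P := P) (.braid A.as D.as) :=
  Quotient.sound (.hexagon _ _ _)

/-- The symmetry, as an isomorphism. -/
def braidIso (A B : P.Presented) : A ⊗ B ≅ B ⊗ A :=
  ⟨homMk (.braid A.as B.as), homMk (.braid B.as A.as), symmetry_aux P A B, symmetry_aux P B A⟩

instance : SymmetricCategory P.Presented where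
  braiding := braidIso P
  braiding_naturality_right := by
    rintro A B D ⟨f⟩
    exact Quotient.sound (.braid_naturality _ _)
  braiding_naturality_left := by
    rintro A B ⟨f⟩ D
    exact Quotient.sound (.braid_naturality _ _)
  hexagon_forward := hexagon_aux P
  hexagon_reverse := by
    intro A B D
    have h : α_ D A B ≪≫ braidIso P D (A ⊗ B) ≪≫ α_ A B D =
        whiskerRightIso (braidIso P D A) B ≪≫ α_ A D B ≪≫ whiskerLeftIso A (braidIso P D B) :=
      Iso.ext (hexagon_aux P D A B)
    have h' := congrArg Iso.inv h
    simp only [Iso.trans_inv, whiskerRightIso_inv, whiskerLeftIso_inv, Category.assoc] at h'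
    exact h'
  symmetry := symmetry_aux P

end Presented

end SMCPresentation

/-! ## Dagger symmetric monoidal categories and isometries -/

/-- A dagger symmetric monoidal category: an identity-on-objects involutive contravariant
functor which preserves the symmetric monoidal structure. The category is not required to be
strict. If it is strict, that is, if the associators and unitors are identities, then
`dag_associator`, `dag_leftUnitor` and `dag_rightUnitor` follow from the other axioms. -/
class DaggerSymmetricCategory (C : Type u) [Category.{v} C] [MonoidalCategory C]
    [SymmetricCategory C] where
  dag : ∀ {A B : C}, (A ⟶ B) → (B ⟶ A)
  dag_dag : ∀ {A B : C} (f : A ⟶ B), dag (dag f) = f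
  dag_id : ∀ A : C, dag (𝟙 A) = 𝟙 A
  dag_comp : ∀ {A B D : C} (f : A ⟶ B) (g : B ⟶ D), dag (f ≫ g) = dag g ≫ dag f
  dag_tensor : ∀ {A B A' B' : C} (f : A ⟶ B) (g : A' ⟶ B'), dag (f ⊗ₘ g) = dag f ⊗ₘ dag g
  dag_associator : ∀ A B D : C, dag (α_ A B D).hom = (α_ A B D).inv
  dag_leftUnitor : ∀ A : C, dag (λ_ A).hom = (λ_ A).inv
  dag_rightUnitor : ∀ A : C, dag (ρ_ A).hom = (ρ_ A).inv
  dag_braiding : ∀ A B : C, dag (β_ A B).hom = (β_ B A).hom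

open DaggerSymmetricCategory (dag)

section Construction

variable (C : Type u) [Category.{v} C] [MonoidalCategory C]

section Affine

variable [SymmetricCategory C]

/-! ## The affine completion of a symmetric monoidal category -/

/-- The generators of the affine completion: the morphisms of `C`, and a morphism from each
object to the unit. -/
inductive AffineGen : C → C → Type (max u v)
  | of {A B : C} (f : A ⟶ B) : AffineGen A B
  | bang (A : C) : AffineGen A (𝟙_ C)

/-- The signature of the affine completion. -/
def affineSignature : SMCSignature.{max u v} C where
  tens A B := A ⊗ B
  unit := 𝟙_ C
  Gen := AffineGen C

open Term AffineGen in
/-- The equations of the affine completion: those of `C` (the inclusion of `C` is a strict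
symmetric monoidal functor), and those which make the added morphism `!_A` the only morphism
from `A` to the unit. -/
inductive AffineRel : ∀ {A B : C}, Term (affineSignature C) A B → Term (affineSignature C) A B →
    Prop
  | of_id (A : C) : AffineRel (gen (of (𝟙 A))) (one A)
  | of_comp {A B D : C} (f : A ⟶ B) (g : B ⟶ D) :
      AffineRel (gen (of (f ≫ g))) (comp (gen (of f)) (gen (of g)))
  | of_tensor {A B A' B' : C} (f : A ⟶ B) (g : A' ⟶ B') :
      AffineRel (gen (of (f ⊗ₘ g))) (tensor (gen (of f)) (gen (of g)))
  | of_associator (A B D : C) : AffineRel (gen (of (α_ A B D).hom)) (assocHom A B D)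
  | of_leftUnitor (A : C) : AffineRel (gen (of (λ_ A).hom)) (leftHom A)
  | of_rightUnitor (A : C) : AffineRel (gen (of (ρ_ A).hom)) (rightHom A)
  | of_braiding (A B : C) : AffineRel (gen (of (β_ A B).hom)) (braid A B)
  | bang_unit : AffineRel (gen (bang (𝟙_ C))) (one (𝟙_ C))
  | comp_bang {A B : C} (t : Term (affineSignature C) A B) :
      AffineRel (comp t (gen (bang B))) (gen (bang A))

/-- The presentation of the affine completion. -/
def affinePresentation : SMCPresentation.{max u v} C where
  toSMCSignature := affineSignature C
  Rel := AffineRel C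

/-- The affine completion of `C`: the symmetric monoidal category obtained from `C` by making
the unit terminal. -/
abbrev Affine := (affinePresentation C).Presented

variable {C}

/-- The inclusion of `C` in its affine completion. -/
def Affine.incl : C ⥤ Affine C where
  obj A := ⟨A⟩
  map f := SMCPresentation.Presented.homMk (P := affinePresentation C) (.gen (.of f))
  map_id A := Quotient.sound (.rel (.of_id A))
  map_comp f g := Quotient.sound (.rel (.of_comp f g))

/-- The morphism `!_A` of the affine completion. -/
def Affine.bang (A : C) : Affine.incl.obj A ⟶ 𝟙_ (Affine C) :=
  SMCPresentation.Presented.homMk (P := affinePresentation C) (.gen (.bang A))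

theorem Affine.comp_bang {A B : C} (f : Affine.incl.obj A ⟶ Affine.incl.obj B) :
    f ≫ Affine.bang B = Affine.bang A := by
  obtain ⟨t⟩ := f
  exact Quotient.sound (.rel (.comp_bang t))

theorem Affine.eq_bang {A : C} (f : Affine.incl.obj A ⟶ 𝟙_ (Affine C)) : f = Affine.bang A := by
  have h : Affine.bang (𝟙_ C) = 𝟙 (𝟙_ (Affine C)) := Quotient.sound (.rel .bang_unit)
  have h' := Affine.comp_bang (B := 𝟙_ C) f
  rw [h] at h'
  exact (Category.comp_id f).symm.trans h'

end Affine

/-! ## The subcategory of isometries -/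

variable [SymmetricCategory C] [DaggerSymmetricCategory C]

/-- `f` is an isometry if `f† ∘ f = 1`. -/
def isometries : MorphismProperty C := fun A _ f => f ≫ dag f = 𝟙 A

open DaggerSymmetricCategory in
instance isometries_isMultiplicative : (isometries C).IsMultiplicative where
  id_mem A := by simp [isometries, dag_id]
  comp_mem {A B D} f g hf hg := by
    simp only [isometries] at hf hg ⊢
    rw [dag_comp, Category.assoc, ← Category.assoc g, hg, Category.id_comp, hf]

open DaggerSymmetricCategory in
instance isometries_isStableUnderBraiding : (isometries C).IsStableUnderBraiding :=
  have : (isometries C).IsMonoidal := .mk' _ (by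
    intro A A' B B' f g hf hg
    simp only [isometries] at hf hg ⊢
    rw [dag_tensor, tensorHom_comp_tensorHom, hf, hg, id_tensorHom_id])
  { associator_hom_mem A B D := by simp [isometries, dag_associator]
    associator_inv_mem A B D := by
      rw [isometries, ← dag_associator, dag_dag, dag_associator, Iso.inv_hom_id]
    leftUnitor_hom_mem A := by simp [isometries, dag_leftUnitor]
    leftUnitor_inv_mem A := by
      rw [isometries, ← dag_leftUnitor, dag_dag, dag_leftUnitor, Iso.inv_hom_id]
    rightUnitor_hom_mem A := by simp [isometries, dag_rightUnitor]
    rightUnitor_inv_mem A := by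
      rw [isometries, ← dag_rightUnitor, dag_dag, dag_rightUnitor, Iso.inv_hom_id]
    braiding_hom_mem A B := by simp [isometries, dag_braiding]
    braiding_inv_mem A B := by
      simp [isometries, ← SymmetricCategory.braiding_swap_eq_inv_braiding, dag_braiding] }

/-- The symmetric monoidal subcategory of isometries of `C`, with all the objects of `C`. -/
abbrev IsoCat := WideSubcategory (isometries C)

/-! ## The discard construction -/

/-- The object `A` of `C`, as an object of the affine completion of the isometries of `C`. -/
abbrev affObj (A : C) : Affine (IsoCat C) := ⟨⟨A⟩⟩

/-- The generators of the discard construction: the morphisms of `C`, and the morphisms of the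
affine completion of the isometries of `C`. -/
inductive DiscardGen : C → C → Type (max u v)
  | ofC {A B : C} (f : A ⟶ B) : DiscardGen A B
  | ofAff {A B : C} (h : affObj C A ⟶ affObj C B) : DiscardGen A B

/-- The signature of the discard construction. -/
def discardSignature : SMCSignature.{max u v} C where
  tens A B := A ⊗ B
  unit := 𝟙_ C
  Gen := DiscardGen C

open Term DiscardGen in
/-- The equations of the discard construction: those of `C`, those of the affine completion of
the isometries of `C` (both inclusions are strict symmetric monoidal functors), and the
identification of the two copies of each isometry. -/
inductive DiscardRel : ∀ {A B : C}, Term (discardSignature C) A B →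
    Term (discardSignature C) A B → Prop
  | ofC_id (A : C) : DiscardRel (gen (ofC (𝟙 A))) (one A)
  | ofC_comp {A B D : C} (f : A ⟶ B) (g : B ⟶ D) :
      DiscardRel (gen (ofC (f ≫ g))) (comp (gen (ofC f)) (gen (ofC g)))
  | ofC_tensor {A B A' B' : C} (f : A ⟶ B) (g : A' ⟶ B') :
      DiscardRel (gen (ofC (f ⊗ₘ g))) (tensor (gen (ofC f)) (gen (ofC g)))
  | ofC_associator (A B D : C) : DiscardRel (gen (ofC (α_ A B D).hom)) (assocHom A B D)
  | ofC_leftUnitor (A : C) : DiscardRel (gen (ofC (λ_ A).hom)) (leftHom A)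
  | ofC_rightUnitor (A : C) : DiscardRel (gen (ofC (ρ_ A).hom)) (rightHom A)
  | ofC_braiding (A B : C) : DiscardRel (gen (ofC (β_ A B).hom)) (braid A B)
  | ofAff_id (A : C) : DiscardRel (gen (ofAff (𝟙 (affObj C A)))) (one A)
  | ofAff_comp {A B D : C} (f : affObj C A ⟶ affObj C B) (g : affObj C B ⟶ affObj C D) :
      DiscardRel (gen (ofAff (f ≫ g))) (comp (gen (ofAff f)) (gen (ofAff g)))
  | ofAff_tensor {A B A' B' : C} (f : affObj C A ⟶ affObj C B)
      (g : affObj C A' ⟶ affObj C B') :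
      DiscardRel (gen (ofAff (A := A ⊗ A') (B := B ⊗ B') (f ⊗ₘ g)))
        (tensor (gen (ofAff f)) (gen (ofAff g)))
  | ofAff_associator (A B D : C) :
      DiscardRel (gen (ofAff (A := (A ⊗ B) ⊗ D) (B := A ⊗ (B ⊗ D))
        (α_ (affObj C A) (affObj C B) (affObj C D)).hom)) (assocHom A B D)
  | ofAff_leftUnitor (A : C) :
      DiscardRel (gen (ofAff (A := 𝟙_ C ⊗ A) (B := A) (λ_ (affObj C A)).hom)) (leftHom A)
  | ofAff_rightUnitor (A : C) :
      DiscardRel (gen (ofAff (A := A ⊗ 𝟙_ C) (B := A) (ρ_ (affObj C A)).hom)) (rightHom A)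
  | ofAff_braiding (A B : C) :
      DiscardRel (gen (ofAff (A := A ⊗ B) (B := B ⊗ A) (β_ (affObj C A) (affObj C B)).hom))
        (braid A B)
  | glue {A B : C} (u : (⟨A⟩ : IsoCat C) ⟶ ⟨B⟩) :
      DiscardRel (gen (ofC ((wideSubcategoryInclusion (isometries C)).map u)))
        (gen (ofAff (Affine.incl.map u)))

/-- The presentation of the discard construction. -/
def discardPresentation : SMCPresentation.{max u v} C where
  toSMCSignature := discardSignature C
  Rel := DiscardRel C

/-- The discard construction on `C`: the identity-on-objects pushout of symmetric monoidal
categories of `C` and the affine completion of the isometries of `C`, over the isometries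
of `C`. -/
abbrev Discard := (discardPresentation C).Presented

namespace Discard

variable {C}

/-- The functor from `C` to the discard construction. -/
def ofC : C ⥤ Discard C where
  obj A := ⟨A⟩
  map f := SMCPresentation.Presented.homMk (P := discardPresentation C) (.gen (.ofC f))
  map_id A := Quotient.sound (.rel (.ofC_id A))
  map_comp f g := Quotient.sound (.rel (.ofC_comp f g))

/-- The functor from the affine completion of the isometries to the discard construction. -/
def ofAff : Affine (IsoCat C) ⥤ Discard C where
  obj A := ⟨A.as.obj⟩
  map h := SMCPresentation.Presented.homMk (P := discardPresentation C) (.gen (.ofAff h))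
  map_id A := Quotient.sound (.rel (.ofAff_id A.as.obj))
  map_comp f g := Quotient.sound (.rel (.ofAff_comp f g))

/-- The discard map on `A`. -/
def ground (A : C) : ofC.obj A ⟶ 𝟙_ (Discard C) :=
  ofAff.map (Affine.bang (⟨A⟩ : IsoCat C))

/-- The morphism `1_B ⊗ ground_X` from `B ⊗ X` to `B`. The functor `ofC` is strict monoidal:
`ofC.obj (B ⊗ X)` is `ofC.obj B ⊗ ofC.obj X` by definition. -/
def discardRight (B X : C) : (ofC.obj (B ⊗ X) : Discard C) ⟶ ofC.obj B :=
  (ofC.obj B ◁ ground X : ofC.obj B ⊗ ofC.obj X ⟶ _) ≫ (ρ_ (ofC.obj B)).hom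

/-- For `f : A ⟶ B ⊗ X`, the morphism from `A` to `B` of the discard construction obtained from
`f` by discarding `X`. -/
def discardEnv {A B X : C} (f : A ⟶ B ⊗ X) : (ofC.obj A : Discard C) ⟶ ofC.obj B :=
  ofC.map f ≫ discardRight B X

/-- `f : A ⟶ B ⊗ X` is a purification of `h`. -/
def IsPurification {A B X : C} (f : A ⟶ B ⊗ X) (h : (ofC.obj A : Discard C) ⟶ ofC.obj B) :
    Prop :=
  h = discardEnv f

end Discard

variable {C} in
/-- Two morphisms `A ⟶ B ⊗ X` and `A ⟶ B ⊗ Y` are related if they become equal after applying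
an isometry `X ⟶ Z` to the first one and an isometry `Y ⟶ Z` to the second one. -/
def IsoRel {A B : C} (p q : Σ X : C, A ⟶ B ⊗ X) : Prop :=
  ∃ (Z : C) (a : p.1 ⟶ Z) (b : q.1 ⟶ Z), isometries C a ∧ isometries C b ∧
    p.2 ≫ B ◁ a = q.2 ≫ B ◁ b

end Construction

end DiscardConstruction

open DiscardConstruction

namespace DiscardConstruction

variable {C : Type u} [Category.{v} C] [MonoidalCategory C] [SymmetricCategory C]
  [DaggerSymmetricCategory C]

/-! From left to right, gluing makes each isometry `u : X ⟶ Z` a morphism of the affine completion,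
where `!` absorbs it; so an isometry on the environment disappears once the environment is discarded
(`map_comp_ground`).

For the converse, a model of the discard construction is built in which the classes can be read off.
In `EnvCat C` a morphism from `A` to `B` is a class of morphisms `A ⟶ B ⊗ X` of `C` under the
equivalence generated by `IsoRel`. This is a symmetric monoidal category, because its laws hold up
to coherence isomorphisms on the environment, and these are isometries. A morphism of `C` gets the
trivial environment, and `!_A` becomes the morphism `discard A` that puts all of `A` in the
environment. The unit need not be terminal in this model, but `discard` absorbs every class
represented by an isometry (`IsIsometric.comp_discard`), and the whole affine completion lands in
such classes (`isIsometric_evalAffine`). Hence all the equations hold in the model. The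
interpretation sends `discardEnv f` to the class of `f` (`ofDiscard_discardEnv`), so equal discarded
morphisms have equivalent purifications. -/

theorem IsoRel.refl {A B : C} (p : Σ X : C, A ⟶ B ⊗ X) : IsoRel p p :=
  ⟨p.1, 𝟙 _, 𝟙 _, (isometries C).id_mem _, (isometries C).id_mem _, rfl⟩

theorem IsoRel.symm {A B : C} {p q : Σ X : C, A ⟶ B ⊗ X} (h : IsoRel p q) : IsoRel q p := by
  obtain ⟨Z, a, b, ha, hb, h⟩ := h
  exact ⟨Z, b, a, hb, ha, h.symm⟩

instance {A B : C} : Std.Symm (IsoRel (A := A) (B := B)) := ⟨fun _ _ ↦ IsoRel.symm⟩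

/-- `IsoRel` is reflexive and symmetric, so its transitive closure is already the equivalence
relation by which `Quot` identifies representatives. -/
theorem transGen_isoRel_of_eqvGen {A B : C} {p q : Σ X : C, A ⟶ B ⊗ X}
    (h : Relation.EqvGen IsoRel p q) : Relation.TransGen IsoRel p q := by
  induction h with
  | rel _ _ h => exact .single h
  | refl p => exact .single (.refl p)
  | symm _ _ _ h => exact Std.Symm.symm _ _ h
  | trans _ _ _ _ _ h₁ h₂ => exact h₁.trans h₂

/-! ### The category of morphisms with an environment -/

variable (C) in
/-- The category with the objects of `C`, in which a morphism from `A` to `B` is a class of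
morphisms `A ⟶ B ⊗ X` of `C` modulo isometries on the environment `X`. -/
structure EnvCat where
  as : C

namespace EnvCat

/-- The composite of two morphisms with an environment. -/
def compRep {A B D : C} (p : Σ X : C, A ⟶ B ⊗ X) (q : Σ X : C, B ⟶ D ⊗ X) :
    Σ X : C, A ⟶ D ⊗ X :=
  ⟨q.1 ⊗ p.1, p.2 ≫ q.2 ▷ p.1 ≫ (α_ D q.1 p.1).hom⟩

theorem compRep_right {A B D : C} (p : Σ X : C, A ⟶ B ⊗ X) (q q' : Σ X : C, B ⟶ D ⊗ X)
    (h : IsoRel q q') : IsoRel (compRep p q) (compRep p q') := by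
  obtain ⟨Z, a, b, ha, hb, h⟩ := h
  refine ⟨Z ⊗ p.1, a ▷ p.1, b ▷ p.1, (isometries C).whiskerRight_mem _ ha _,
    (isometries C).whiskerRight_mem _ hb _, ?_⟩
  have h' := congrArg (fun k ↦ p.2 ≫ k ▷ p.1 ≫ (α_ D Z p.1).hom) h
  simpa [compRep] using h'

theorem compRep_left {A B D : C} (p p' : Σ X : C, A ⟶ B ⊗ X) (q : Σ X : C, B ⟶ D ⊗ X)
    (h : IsoRel p p') : IsoRel (compRep p q) (compRep p' q) := by
  obtain ⟨Z, a, b, ha, hb, h⟩ := h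
  refine ⟨q.1 ⊗ Z, q.1 ◁ a, q.1 ◁ b, (isometries C).whiskerLeft_mem _ _ ha,
    (isometries C).whiskerLeft_mem _ _ hb, ?_⟩
  have h' := congrArg (fun k ↦ k ≫ q.2 ▷ Z ≫ (α_ D q.1 Z).hom) h
  -- The isometry acts on the old environment and `q.2` on the system, so they commute by the
  -- interchange law.
  simp only [Category.assoc, whisker_exchange_assoc] at h'
  simpa [compRep] using h'

/-- A morphism with an environment, whiskered on the left. -/
def whiskerLeftRep (A : C) {B D : C} (p : Σ X : C, B ⟶ D ⊗ X) :
    Σ X : C, A ⊗ B ⟶ (A ⊗ D) ⊗ X :=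
  ⟨p.1, A ◁ p.2 ≫ (α_ A D p.1).inv⟩

theorem whiskerLeftRep_congr (A : C) {B D : C} (p q : Σ X : C, B ⟶ D ⊗ X)
    (h : IsoRel p q) : IsoRel (whiskerLeftRep A p) (whiskerLeftRep A q) := by
  obtain ⟨Z, a, b, ha, hb, h⟩ := h
  refine ⟨Z, a, b, ha, hb, ?_⟩
  have h' := congrArg (fun k ↦ A ◁ k ≫ (α_ A D Z).inv) h
  simpa [whiskerLeftRep] using h'

instance : CategoryStruct.{max u v} (EnvCat C) where
  Hom A B := Quot (IsoRel (A := A.as) (B := B.as))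
  id A := Quot.mk _ ⟨𝟙_ C, (ρ_ A.as).inv⟩
  comp := Quot.map₂ compRep compRep_right compRep_left

/-- The class of a morphism with an environment. -/
def homMk {A B X : C} (f : A ⟶ B ⊗ X) : (⟨A⟩ : EnvCat C) ⟶ ⟨B⟩ :=
  Quot.mk _ ⟨X, f⟩

theorem homMk_surjective {A B : EnvCat C} (h : A ⟶ B) : ∃ (X : C) (f : A.as ⟶ B.as ⊗ X), homMk f = h := by
  obtain ⟨X, f⟩ := h
  exact ⟨X, f, rfl⟩

theorem homMk_eq_iff {A B X Y : C} (f : A ⟶ B ⊗ X) (g : A ⟶ B ⊗ Y) :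
    homMk f = homMk g ↔ Relation.TransGen IsoRel ⟨X, f⟩ ⟨Y, g⟩ := by
  refine ⟨fun h ↦ transGen_isoRel_of_eqvGen (Quot.eqvGen_exact h), fun h ↦ ?_⟩
  exact Quot.eqvGen_sound (Relation.EqvGen.transGen_le_eqvGen _ _ _ h)

/-- The one-sided case, with the identity as second isometry. It suffices for the laws below, where
`u` is a structural isomorphism between the two environments. -/
theorem homMk_eq_of_isometry {A B X Y : C} {f : A ⟶ B ⊗ X} {g : A ⟶ B ⊗ Y} (u : X ⟶ Y)
    (hu : isometries C u) (h : f ≫ B ◁ u = g) : homMk f = homMk g :=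
  Quot.sound ⟨Y, u, 𝟙 Y, hu, (isometries C).id_mem _, by simpa using h⟩

theorem homMk_comp_homMk {A B D X Y : C} (f : A ⟶ B ⊗ X) (g : B ⟶ D ⊗ Y) :
    homMk f ≫ homMk g = homMk (f ≫ g ▷ X ≫ (α_ D Y X).hom) := rfl

theorem id_def (A : C) : 𝟙 (⟨A⟩ : EnvCat C) = homMk (ρ_ A).inv := rfl

/-- On representatives the laws fail only by a unitor or an associator of the environments, which is
an isometry. -/
instance : Category.{max u v} (EnvCat C) where
  id_comp h := by
    obtain ⟨X, f, rfl⟩ := homMk_surjective h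
    rw [id_def, homMk_comp_homMk]
    exact homMk_eq_of_isometry (ρ_ X).hom ((isometries C).rightUnitor_hom_mem _) (by monoidal)
  comp_id h := by
    obtain ⟨X, f, rfl⟩ := homMk_surjective h
    rw [id_def, homMk_comp_homMk]
    exact homMk_eq_of_isometry (λ_ X).hom ((isometries C).leftUnitor_hom_mem _) (by monoidal)
  assoc h₁ h₂ h₃ := by
    obtain ⟨X, f, rfl⟩ := homMk_surjective h₁
    obtain ⟨Y, g, rfl⟩ := homMk_surjective h₂
    obtain ⟨Z, k, rfl⟩ := homMk_surjective h₃
    simp only [homMk_comp_homMk]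
    exact homMk_eq_of_isometry (α_ Z Y X).inv ((isometries C).associator_inv_mem _ _ _)
      (by monoidal)

/-! ### Morphisms of `C` with trivial environment -/

/-- A morphism of `C`, as a morphism with trivial environment. -/
def incl {A B : C} (f : A ⟶ B) : (⟨A⟩ : EnvCat C) ⟶ ⟨B⟩ :=
  homMk (f ≫ (ρ_ B).inv)

theorem incl_comp_homMk {A B D X : C} (f : A ⟶ B) (g : B ⟶ D ⊗ X) :
    incl f ≫ homMk g = homMk (f ≫ g) :=
  homMk_eq_of_isometry (ρ_ X).hom ((isometries C).rightUnitor_hom_mem _) (by monoidal)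

theorem homMk_comp_incl {A B D X : C} (f : A ⟶ B ⊗ X) (g : B ⟶ D) :
    homMk f ≫ incl g = homMk (f ≫ g ▷ X) :=
  homMk_eq_of_isometry (λ_ X).hom ((isometries C).leftUnitor_hom_mem _) (by monoidal)

@[simp]
theorem incl_id (A : C) : incl (𝟙 A) = 𝟙 _ := by
  simp [incl, id_def]

theorem incl_comp {A B D : C} (f : A ⟶ B) (g : B ⟶ D) : incl (f ≫ g) = incl f ≫ incl g := by
  rw [incl, incl, homMk_comp_incl]
  congr 1
  monoidal

/-- An isomorphism of `C`, as an isomorphism with trivial environment. -/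
def inclIso {A B : C} (e : A ≅ B) : (⟨A⟩ : EnvCat C) ≅ ⟨B⟩ where
  hom := incl e.hom
  inv := incl e.inv
  hom_inv_id := by simp [← incl_comp]
  inv_hom_id := by simp [← incl_comp]

/-! ### Whiskering and the monoidal structure -/

/-- The left whiskering of morphisms with an environment. -/
def whiskerLeftHom (A : C) {B D : C} (h : (⟨B⟩ : EnvCat C) ⟶ ⟨D⟩) :
    (⟨A ⊗ B⟩ : EnvCat C) ⟶ ⟨A ⊗ D⟩ :=
  Quot.map (whiskerLeftRep A) (whiskerLeftRep_congr A) h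

theorem whiskerLeftHom_homMk (A : C) {B D X : C} (f : B ⟶ D ⊗ X) :
    whiskerLeftHom A (homMk f) = homMk (A ◁ f ≫ (α_ A D X).inv) := rfl

theorem whiskerLeftHom_incl (A : C) {B D : C} (f : B ⟶ D) :
    whiskerLeftHom A (incl f) = incl (A ◁ f) := by
  simp only [incl, whiskerLeftHom_homMk]
  congr 1
  monoidal

/-- The symmetry. -/
abbrev swap (A B : C) : (⟨A ⊗ B⟩ : EnvCat C) ⟶ ⟨B ⊗ A⟩ := incl (β_ A B).hom

@[simp]
theorem swap_swap (A B : C) : swap A B ≫ swap B A = 𝟙 _ := by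
  rw [← incl_comp, SymmetricCategory.symmetry, incl_id]

@[simp]
theorem swap_swap_assoc (A B : C) {D : EnvCat C} (h : (⟨A ⊗ B⟩ : EnvCat C) ⟶ D) :
    swap A B ≫ swap B A ≫ h = h := by
  rw [← Category.assoc, swap_swap, Category.id_comp]

/-- The right whiskering of morphisms with an environment. -/
def whiskerRightHom {B D : C} (h : (⟨B⟩ : EnvCat C) ⟶ ⟨D⟩) (A : C) :
    (⟨B ⊗ A⟩ : EnvCat C) ⟶ ⟨D ⊗ A⟩ :=
  swap B A ≫ whiskerLeftHom A h ≫ swap A D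

theorem whiskerRightHom_incl {B D : C} (f : B ⟶ D) (A : C) :
    whiskerRightHom (incl f) A = incl (f ▷ A) := by
  rw [whiskerRightHom, whiskerLeftHom_incl, ← incl_comp, ← incl_comp]
  simp

theorem whiskerLeftHom_id (A B : C) : whiskerLeftHom A (𝟙 (⟨B⟩ : EnvCat C)) = 𝟙 _ := by
  rw [id_def, whiskerLeftHom_homMk, id_def]
  congr 1
  monoidal

theorem whiskerLeftHom_comp (A : C) {B D E : C} (h : (⟨B⟩ : EnvCat C) ⟶ ⟨D⟩)
    (k : (⟨D⟩ : EnvCat C) ⟶ ⟨E⟩) :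
    whiskerLeftHom A (h ≫ k) = whiskerLeftHom A h ≫ whiskerLeftHom A k := by
  obtain ⟨X, f, rfl⟩ := homMk_surjective h
  obtain ⟨Y, g, rfl⟩ := homMk_surjective k
  simp only [homMk_comp_homMk, whiskerLeftHom_homMk]
  congr 1
  monoidal

/-- Conjugating left whiskering by the symmetry makes right whiskering well defined on classes at no
cost. This representative shows its effect: the environment `X` is moved past `A`. -/
theorem whiskerRightHom_homMk {B D X : C} (f : B ⟶ D ⊗ X) (A : C) :
    whiskerRightHom (homMk f) A =
      homMk (f ▷ A ≫ (α_ D X A).hom ≫ D ◁ (β_ X A).hom ≫ (α_ D A X).inv) := by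
  rw [whiskerRightHom, whiskerLeftHom_homMk, homMk_comp_incl, incl_comp_homMk]
  congr 1
  rw [Category.assoc, ← BraidedCategory.braiding_naturality_left_assoc]
  simp [← comp_whiskerRight]

/-- The two orders of composition collect the environments as `X ⊗ Y` and `Y ⊗ X`. They agree in the
quotient because the symmetry is an isometry. -/
theorem whiskerHom_exchange {A B A' B' : C} (h : (⟨A⟩ : EnvCat C) ⟶ ⟨B⟩)
    (k : (⟨A'⟩ : EnvCat C) ⟶ ⟨B'⟩) :
    whiskerLeftHom A k ≫ whiskerRightHom h B' = whiskerRightHom h A' ≫ whiskerLeftHom B k := by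
  obtain ⟨X, f, rfl⟩ := homMk_surjective h
  obtain ⟨Y, g, rfl⟩ := homMk_surjective k
  simp only [whiskerLeftHom_homMk, whiskerRightHom_homMk, homMk_comp_homMk]
  dsimp only at f g ⊢
  refine homMk_eq_of_isometry (β_ X Y).hom ((isometries C).braiding_hom_mem _ _) ?_
  -- The environment left by `f` can cross before or after `g` acts.
  have h₁ : (β_ X A').hom ≫ g ▷ X = X ◁ g ≫ (β_ X (B' ⊗ Y)).hom :=
    (BraidedCategory.braiding_naturality_right X g).symm
  have h₂ := congrArg (fun k ↦ (f ▷ A' ≫ (α_ B X A').hom ≫ B ◁ k ≫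
    (α_ B (B' ⊗ Y) X).inv ≫ (α_ B B' Y).inv ▷ X ≫ (α_ (B ⊗ B') Y X).hom)) h₁
  simp at h₂ ⊢
  rw [h₂, ← associator_inv_naturality_left_assoc, whisker_exchange_assoc]
  monoidal

theorem whiskerLeftHom_tensor (A B : C) {D E : C} (h : (⟨D⟩ : EnvCat C) ⟶ ⟨E⟩) :
    whiskerLeftHom (A ⊗ B) h ≫ incl (α_ A B E).hom =
      incl (α_ A B D).hom ≫ whiskerLeftHom A (whiskerLeftHom B h) := by
  obtain ⟨X, g, rfl⟩ := homMk_surjective h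
  simp only [whiskerLeftHom_homMk, homMk_comp_incl, incl_comp_homMk]
  congr 1
  dsimp only at g ⊢
  monoidal

theorem whiskerLeftHom_unit {A B : C} (h : (⟨A⟩ : EnvCat C) ⟶ ⟨B⟩) :
    whiskerLeftHom (𝟙_ C) h ≫ incl (λ_ B).hom = incl (λ_ A).hom ≫ h := by
  obtain ⟨X, g, rfl⟩ := homMk_surjective h
  simp only [whiskerLeftHom_homMk, homMk_comp_incl, incl_comp_homMk]
  congr 1
  dsimp only at g ⊢
  monoidal

instance : MonoidalCategoryStruct (EnvCat C) where
  tensorObj A B := ⟨A.as ⊗ B.as⟩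
  tensorUnit := ⟨𝟙_ C⟩
  whiskerLeft A _ _ h := whiskerLeftHom A.as h
  whiskerRight h A := whiskerRightHom h A.as
  associator A B D := inclIso (α_ A.as B.as D.as)
  leftUnitor A := inclIso (λ_ A.as)
  rightUnitor A := inclIso (ρ_ A.as)

theorem id_whiskerRightHom (A B : C) : whiskerRightHom (𝟙 (⟨A⟩ : EnvCat C)) B = 𝟙 _ := by
  rw [whiskerRightHom, whiskerLeftHom_id, Category.id_comp, swap_swap]

theorem whiskerRightHom_comp {B D E : C} (h : (⟨B⟩ : EnvCat C) ⟶ ⟨D⟩)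
    (k : (⟨D⟩ : EnvCat C) ⟶ ⟨E⟩) (A : C) :
    whiskerRightHom (h ≫ k) A = whiskerRightHom h A ≫ whiskerRightHom k A := by
  simp [whiskerRightHom, whiskerLeftHom_comp]

theorem whiskerRightHom_whiskerLeftHom (A : C) {B E : C} (h : (⟨B⟩ : EnvCat C) ⟶ ⟨E⟩) (D : C) :
    whiskerRightHom (whiskerLeftHom A h) D ≫ incl (α_ A E D).hom =
      incl (α_ A B D).hom ≫ whiskerLeftHom A (whiskerRightHom h D) := by
  obtain ⟨X, g, rfl⟩ := homMk_surjective h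
  simp only [whiskerLeftHom_homMk, whiskerRightHom_homMk, homMk_comp_incl, incl_comp_homMk]
  congr 1
  dsimp only at g ⊢
  monoidal

theorem whiskerRightHom_whiskerRightHom {A E : C} (h : (⟨A⟩ : EnvCat C) ⟶ ⟨E⟩) (B D : C) :
    whiskerRightHom (whiskerRightHom h B) D ≫ incl (α_ E B D).hom =
      incl (α_ A B D).hom ≫ whiskerRightHom h (B ⊗ D) := by
  obtain ⟨X, g, rfl⟩ := homMk_surjective h
  simp only [whiskerRightHom_homMk, homMk_comp_incl, incl_comp_homMk]
  congr 1
  dsimp only at g ⊢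
  -- The environment crosses `B ⊗ D` in one move on one side, and crosses `B` and then `D` on the
  -- other.
  rw [BraidedCategory.braiding_tensor_right_hom]
  monoidal

theorem whiskerRightHom_unit {A B : C} (h : (⟨A⟩ : EnvCat C) ⟶ ⟨B⟩) :
    whiskerRightHom h (𝟙_ C) ≫ incl (ρ_ B).hom = incl (ρ_ A).hom ≫ h := by
  obtain ⟨X, g, rfl⟩ := homMk_surjective h
  simp only [whiskerRightHom_homMk, homMk_comp_incl, incl_comp_homMk]
  congr 1
  dsimp only at g ⊢
  rw [braiding_tensorUnit_right]
  monoidal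

/-- The tensor product of morphisms with an environment. -/
abbrev tensorHom' {A A' B B' : C} (h : (⟨A⟩ : EnvCat C) ⟶ ⟨B⟩) (k : (⟨A'⟩ : EnvCat C) ⟶ ⟨B'⟩) :
    (⟨A ⊗ A'⟩ : EnvCat C) ⟶ ⟨B ⊗ B'⟩ :=
  whiskerRightHom h A' ≫ whiskerLeftHom B k

theorem tensorHom'_comp_tensorHom' {A B D A' B' D' : C} (h₁ : (⟨A⟩ : EnvCat C) ⟶ ⟨B⟩)
    (h₂ : (⟨A'⟩ : EnvCat C) ⟶ ⟨B'⟩) (k₁ : (⟨B⟩ : EnvCat C) ⟶ ⟨D⟩)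
    (k₂ : (⟨B'⟩ : EnvCat C) ⟶ ⟨D'⟩) :
    tensorHom' h₁ h₂ ≫ tensorHom' k₁ k₂ = tensorHom' (h₁ ≫ k₁) (h₂ ≫ k₂) := by
  have h := whiskerHom_exchange k₁ h₂
  simp only [tensorHom', whiskerRightHom_comp, whiskerLeftHom_comp, Category.assoc]
  rw [reassoc_of% h]

/-- Naturality in each variable separately, assembled from the three whiskering lemmas. -/
theorem associator_naturality' {A₁ A₂ A₃ B₁ B₂ B₃ : C} (h₁ : (⟨A₁⟩ : EnvCat C) ⟶ ⟨B₁⟩)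
    (h₂ : (⟨A₂⟩ : EnvCat C) ⟶ ⟨B₂⟩) (h₃ : (⟨A₃⟩ : EnvCat C) ⟶ ⟨B₃⟩) :
    tensorHom' (tensorHom' h₁ h₂) h₃ ≫ incl (α_ B₁ B₂ B₃).hom =
      incl (α_ A₁ A₂ A₃).hom ≫ tensorHom' h₁ (tensorHom' h₂ h₃) := by
  have e₁ := whiskerRightHom_whiskerRightHom h₁ A₂ A₃
  have e₂ := whiskerRightHom_whiskerLeftHom B₁ h₂ A₃
  simp only [tensorHom', whiskerRightHom_comp, whiskerLeftHom_comp, Category.assoc,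
    whiskerLeftHom_tensor]
  rw [reassoc_of% e₂, reassoc_of% e₁]

instance : MonoidalCategory (EnvCat C) where
  tensorHom_def _ _ := rfl
  id_tensorHom_id A B := by
    change tensorHom' (𝟙 (⟨A.as⟩ : EnvCat C)) (𝟙 (⟨B.as⟩ : EnvCat C)) = 𝟙 _
    rw [tensorHom', id_whiskerRightHom, whiskerLeftHom_id, Category.id_comp]
  tensorHom_comp_tensorHom := tensorHom'_comp_tensorHom'
  whiskerLeft_id A B := whiskerLeftHom_id A.as B.as
  id_whiskerRight A B := id_whiskerRightHom A.as B.as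
  associator_naturality := associator_naturality'
  leftUnitor_naturality := whiskerLeftHom_unit
  rightUnitor_naturality := whiskerRightHom_unit
  -- Only morphisms with trivial environment occur in the pentagon and the triangle, so both are
  -- inherited from `C`.
  pentagon A B D E := by
    change whiskerRightHom (incl (α_ A.as B.as D.as).hom) E.as ≫
      incl (α_ A.as (B.as ⊗ D.as) E.as).hom ≫
        whiskerLeftHom A.as (incl (α_ B.as D.as E.as).hom) =
      incl (α_ (A.as ⊗ B.as) D.as E.as).hom ≫ incl (α_ A.as B.as (D.as ⊗ E.as)).hom
    simp only [whiskerRightHom_incl, whiskerLeftHom_incl, ← incl_comp, pentagon]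
  triangle A B := by
    change incl (α_ A.as (𝟙_ C) B.as).hom ≫ whiskerLeftHom A.as (incl (λ_ B.as).hom) =
      whiskerRightHom (incl (ρ_ A.as).hom) B.as
    simp only [whiskerRightHom_incl, whiskerLeftHom_incl, ← incl_comp, triangle]

/-! ### The symmetry -/

theorem whiskerRightHom_swap {A B : C} (h : (⟨A⟩ : EnvCat C) ⟶ ⟨B⟩) (D : C) :
    whiskerRightHom h D ≫ swap B D = swap A D ≫ whiskerLeftHom D h := by
  simp [whiskerRightHom]

theorem whiskerLeftHom_swap {A B : C} (h : (⟨A⟩ : EnvCat C) ⟶ ⟨B⟩) (D : C) :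
    whiskerLeftHom D h ≫ swap D B = swap D A ≫ whiskerRightHom h D := by
  simp [whiskerRightHom]

instance : SymmetricCategory (EnvCat C) where
  braiding A B := inclIso (β_ A.as B.as)
  braiding_naturality_right A _ _ h := whiskerLeftHom_swap h A.as
  braiding_naturality_left h A := whiskerRightHom_swap h A.as
  hexagon_forward A B D := by
    change incl (α_ A.as B.as D.as).hom ≫ incl (β_ A.as (B.as ⊗ D.as)).hom ≫
        incl (α_ B.as D.as A.as).hom =
      whiskerRightHom (incl (β_ A.as B.as).hom) D.as ≫ incl (α_ B.as A.as D.as).hom ≫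
        whiskerLeftHom B.as (incl (β_ A.as D.as).hom)
    simp only [whiskerRightHom_incl, whiskerLeftHom_incl, ← incl_comp,
      BraidedCategory.hexagon_forward]
  hexagon_reverse A B D := by
    change incl (α_ A.as B.as D.as).inv ≫ incl (β_ (A.as ⊗ B.as) D.as).hom ≫
        incl (α_ D.as A.as B.as).inv =
      whiskerLeftHom A.as (incl (β_ B.as D.as).hom) ≫ incl (α_ A.as D.as B.as).inv ≫
        whiskerRightHom (incl (β_ A.as D.as).hom) B.as
    simp only [whiskerRightHom_incl, whiskerLeftHom_incl, ← incl_comp,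
      BraidedCategory.hexagon_reverse]
  symmetry A B := swap_swap A.as B.as

end EnvCat

/-! ### Coherence axioms in the tensor form used by `TermEquiv` -/

section TensorHom

variable {D : Type u} [Category.{v} D] [MonoidalCategory D]

theorem pentagon_tensorHom (X Y Z W : D) :
    ((α_ X Y Z).hom ⊗ₘ 𝟙 W) ≫ (α_ X (Y ⊗ Z) W).hom ≫ (𝟙 X ⊗ₘ (α_ Y Z W).hom) =
      (α_ (X ⊗ Y) Z W).hom ≫ (α_ X Y (Z ⊗ W)).hom := by
  simp

theorem triangle_tensorHom (X Y : D) :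
    (α_ X (𝟙_ D) Y).hom ≫ (𝟙 X ⊗ₘ (λ_ Y).hom) = (ρ_ X).hom ⊗ₘ 𝟙 Y := by
  simp

theorem hexagon_tensorHom [BraidedCategory D] (X Y Z : D) :
    (α_ X Y Z).hom ≫ (β_ X (Y ⊗ Z)).hom ≫ (α_ Y Z X).hom =
      ((β_ X Y).hom ⊗ₘ 𝟙 Z) ≫ (α_ Y X Z).hom ≫ (𝟙 Y ⊗ₘ (β_ X Z).hom) := by
  rw [tensorHom_id, id_tensorHom, BraidedCategory.hexagon_forward]

end TensorHom

namespace EnvCat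

/-! ### The interpretation of the affine completion of the isometries -/

/-- The morphism which keeps its whole input in the environment. -/
def discard (A : C) : (⟨A⟩ : EnvCat C) ⟶ 𝟙_ (EnvCat C) :=
  homMk (B := 𝟙_ C) (λ_ A).inv

/-- The interpretation of the terms of the affine completion of the isometries. -/
def evalAffine : ∀ {A B : IsoCat C}, Term (affineSignature (IsoCat C)) A B →
    ((⟨A.obj⟩ : EnvCat C) ⟶ ⟨B.obj⟩)
  | _, _, .gen (.of f) => incl f.hom
  | _, _, .gen (.bang A) => discard A.obj
  | _, _, .one _ => 𝟙 _
  | _, _, .comp s t => evalAffine s ≫ evalAffine t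
  | _, _, .tensor s t => evalAffine s ⊗ₘ evalAffine t
  | _, _, .assocHom A B D => incl (α_ A.obj B.obj D.obj).hom
  | _, _, .assocInv A B D => incl (α_ A.obj B.obj D.obj).inv
  | _, _, .leftHom A => incl (λ_ A.obj).hom
  | _, _, .leftInv A => incl (λ_ A.obj).inv
  | _, _, .rightHom A => incl (ρ_ A.obj).hom
  | _, _, .rightInv A => incl (ρ_ A.obj).inv
  | _, _, .braid A B => incl (β_ A.obj B.obj).hom

/-- A morphism with an environment is isometric if it is the class of an isometry. -/
def IsIsometric {A B : C} (h : (⟨A⟩ : EnvCat C) ⟶ ⟨B⟩) : Prop :=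
  ∃ (X : C) (f : A ⟶ B ⊗ X), isometries C f ∧ homMk f = h

theorem IsIsometric.incl {A B : C} {f : A ⟶ B} (hf : isometries C f) : IsIsometric (incl f) :=
  ⟨_, _, (isometries C).comp_mem _ _ hf ((isometries C).rightUnitor_inv_mem _), rfl⟩

theorem IsIsometric.comp {A B D : C} {h : (⟨A⟩ : EnvCat C) ⟶ ⟨B⟩} {k : (⟨B⟩ : EnvCat C) ⟶ ⟨D⟩}
    (hh : IsIsometric h) (hk : IsIsometric k) : IsIsometric (h ≫ k) := by
  obtain ⟨X, f, hf, rfl⟩ := hh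
  obtain ⟨Y, g, hg, rfl⟩ := hk
  exact ⟨_, _, (isometries C).comp_mem _ _ hf ((isometries C).comp_mem _ _
    ((isometries C).whiskerRight_mem _ hg _) ((isometries C).associator_hom_mem _ _ _)), rfl⟩

theorem IsIsometric.whiskerLeft (A : C) {B D : C} {h : (⟨B⟩ : EnvCat C) ⟶ ⟨D⟩}
    (hh : IsIsometric h) : IsIsometric (whiskerLeftHom A h) := by
  obtain ⟨X, f, hf, rfl⟩ := hh
  exact ⟨_, _, (isometries C).comp_mem _ _ ((isometries C).whiskerLeft_mem _ _ hf)
    ((isometries C).associator_inv_mem _ _ _), rfl⟩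

theorem IsIsometric.whiskerRight {B D : C} {h : (⟨B⟩ : EnvCat C) ⟶ ⟨D⟩}
    (hh : IsIsometric h) (A : C) : IsIsometric (whiskerRightHom h A) :=
  (IsIsometric.incl ((isometries C).braiding_hom_mem _ _)).comp
    ((hh.whiskerLeft A).comp (.incl ((isometries C).braiding_hom_mem _ _)))

/-- After discarding `B`, the environment is all of `B ⊗ X`. The representative `f : A ⟶ B ⊗ X` is
then itself an isometry from the environment `A` of `discard A` to this one. -/
theorem IsIsometric.comp_discard {A B : C} {h : (⟨A⟩ : EnvCat C) ⟶ ⟨B⟩} (hh : IsIsometric h) :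
    h ≫ discard B = discard A := by
  obtain ⟨X, f, hf, rfl⟩ := hh
  exact (homMk_eq_of_isometry f hf (by monoidal)).symm

theorem discard_unit : discard (𝟙_ C) = 𝟙 (𝟙_ (EnvCat C)) :=
  congrArg homMk unitors_inv_equal

theorem incl_tensorHom {A B A' B' : C} (f : A ⟶ B) (g : A' ⟶ B') :
    incl (f ⊗ₘ g) = incl f ⊗ₘ incl g := by
  change _ = whiskerRightHom (incl f) A' ≫ whiskerLeftHom B (incl g)
  rw [whiskerRightHom_incl, whiskerLeftHom_incl, ← incl_comp, MonoidalCategory.tensorHom_def]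

/-- The relation `comp_bang` ranges over all terms, including those that contain `!`, so absorption
is needed for every term and not only for isometries of `C`. The generator `!_A` causes no
difficulty, being represented by the inverse of a unitor. -/
theorem isIsometric_evalAffine {A B : IsoCat C} (t : Term (affineSignature (IsoCat C)) A B) :
    IsIsometric (evalAffine t) := by
  induction t with
  | gen s =>
    cases s with
    | of f => exact .incl f.property
    | bang => exact ⟨_, _, (isometries C).leftUnitor_inv_mem _, rfl⟩
  | one A => rw [evalAffine, ← incl_id]; exact .incl ((isometries C).id_mem _)
  | comp s t hs ht => exact hs.comp ht
  | tensor s t hs ht => exact (hs.whiskerRight _).comp (ht.whiskerLeft _)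
  | assocHom => exact .incl ((isometries C).associator_hom_mem _ _ _)
  | assocInv => exact .incl ((isometries C).associator_inv_mem _ _ _)
  | leftHom => exact .incl ((isometries C).leftUnitor_hom_mem _)
  | leftInv => exact .incl ((isometries C).leftUnitor_inv_mem _)
  | rightHom => exact .incl ((isometries C).rightUnitor_hom_mem _)
  | rightInv => exact .incl ((isometries C).rightUnitor_inv_mem _)
  | braid => exact .incl ((isometries C).braiding_hom_mem _ _)

theorem evalAffine_eq {A B : IsoCat C}
    {s t : Term (affinePresentation (IsoCat C)).toSMCSignature A B}
    (h : TermEquiv (affinePresentation (IsoCat C)) s t) :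
    evalAffine (C := C) s = evalAffine t := by
  induction h with
  | rel h =>
    cases h with
    | of_id A => exact incl_id _
    | of_comp f g => exact incl_comp _ _
    | of_tensor f g => exact incl_tensorHom _ _
    | of_associator => rfl
    | of_leftUnitor => rfl
    | of_rightUnitor => rfl
    | of_braiding => rfl
    | bang_unit => exact discard_unit
    -- This equation does not hold for arbitrary morphisms of `EnvCat C`; it is where isometries
    -- enter.
    | comp_bang t => exact (isIsometric_evalAffine t).comp_discard
  | refl => rfl
  | symm _ h => exact h.symm
  | trans _ _ h₁ h₂ => exact h₁.trans h₂
  | comp_congr _ _ h₁ h₂ => exact congrArg₂ (· ≫ ·) h₁ h₂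
  | tensor_congr _ _ h₁ h₂ => exact congrArg₂ (· ⊗ₘ ·) h₁ h₂
  | id_comp => exact Category.id_comp _
  | comp_id => exact Category.comp_id _
  | assoc => exact Category.assoc _ _ _
  | tensor_id => exact id_tensorHom_id _ _
  | tensor_comp => exact tensorHom_comp_tensorHom _ _ _ _
  | assoc_hom_inv A B D => exact (inclIso (α_ A.obj B.obj D.obj)).hom_inv_id
  | assoc_inv_hom A B D => exact (inclIso (α_ A.obj B.obj D.obj)).inv_hom_id
  | assoc_naturality => exact associator_naturality _ _ _
  | left_hom_inv A => exact (inclIso (λ_ A.obj)).hom_inv_id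
  | left_inv_hom A => exact (inclIso (λ_ A.obj)).inv_hom_id
  | left_naturality =>
    exact (congrArg (· ≫ _) (id_tensorHom _ _)).trans (leftUnitor_naturality _)
  | right_hom_inv A => exact (inclIso (ρ_ A.obj)).hom_inv_id
  | right_inv_hom A => exact (inclIso (ρ_ A.obj)).inv_hom_id
  | right_naturality =>
    exact (congrArg (· ≫ _) (tensorHom_id _ _)).trans (rightUnitor_naturality _)
  | pentagon A B D E =>
    exact pentagon_tensorHom (D := EnvCat C) ⟨A.obj⟩ ⟨B.obj⟩ ⟨D.obj⟩ ⟨E.obj⟩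
  | triangle A B => exact triangle_tensorHom (D := EnvCat C) ⟨A.obj⟩ ⟨B.obj⟩
  | braid_naturality => exact BraidedCategory.braiding_naturality _ _
  | hexagon A B D => exact hexagon_tensorHom (D := EnvCat C) ⟨A.obj⟩ ⟨B.obj⟩ ⟨D.obj⟩
  | symmetry A B => exact SymmetricCategory.symmetry (C := EnvCat C) ⟨A.obj⟩ ⟨B.obj⟩

/-- The interpretation of the affine completion of the isometries. -/
def ofAffine {A B : C} : (affObj C A ⟶ affObj C B) → ((⟨A⟩ : EnvCat C) ⟶ ⟨B⟩) :=
  Quotient.lift evalAffine fun _ _ ↦ evalAffine_eq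

/-! ### The interpretation of the discard construction -/

/-- The interpretation of the terms of the discard construction. -/
def evalDiscard : ∀ {A B : C}, Term (discardSignature C) A B → ((⟨A⟩ : EnvCat C) ⟶ ⟨B⟩)
  | _, _, .gen (.ofC f) => incl f
  | _, _, .gen (.ofAff h) => ofAffine h
  | _, _, .one _ => 𝟙 _
  | _, _, .comp s t => evalDiscard s ≫ evalDiscard t
  | _, _, .tensor s t => evalDiscard s ⊗ₘ evalDiscard t
  | _, _, .assocHom A B D => incl (α_ A B D).hom
  | _, _, .assocInv A B D => incl (α_ A B D).inv
  | _, _, .leftHom A => incl (λ_ A).hom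
  | _, _, .leftInv A => incl (λ_ A).inv
  | _, _, .rightHom A => incl (ρ_ A).hom
  | _, _, .rightInv A => incl (ρ_ A).inv
  | _, _, .braid A B => incl (β_ A B).hom

theorem evalDiscard_eq {A B : C} {s t : Term (discardPresentation C).toSMCSignature A B}
    (h : TermEquiv (discardPresentation C) s t) : evalDiscard s = evalDiscard t := by
  induction h with
  | rel h =>
    cases h with
    | ofC_id A => exact incl_id _
    | ofC_comp f g => exact incl_comp _ _
    | ofC_tensor f g => exact incl_tensorHom _ _
    | ofC_associator => rfl
    | ofC_leftUnitor => rfl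
    | ofC_rightUnitor => rfl
    | ofC_braiding => rfl
    | ofAff_id => rfl
    -- Once representative terms are chosen, `Quotient.lift` computes and both sides unfold to the
    -- same evaluation.
    | ofAff_comp f g =>
      obtain ⟨f⟩ := f
      obtain ⟨g⟩ := g
      rfl
    | ofAff_tensor f g =>
      obtain ⟨f⟩ := f
      obtain ⟨g⟩ := g
      rfl
    | ofAff_associator => rfl
    | ofAff_leftUnitor => rfl
    | ofAff_rightUnitor => rfl
    | ofAff_braiding => rfl
    -- Both copies of an isometry `u` are interpreted as `incl` of its underlying morphism.
    | glue => rfl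
  | refl => rfl
  | symm _ h => exact h.symm
  | trans _ _ h₁ h₂ => exact h₁.trans h₂
  | comp_congr _ _ h₁ h₂ => exact congrArg₂ (· ≫ ·) h₁ h₂
  | tensor_congr _ _ h₁ h₂ => exact congrArg₂ (· ⊗ₘ ·) h₁ h₂
  | id_comp => exact Category.id_comp _
  | comp_id => exact Category.comp_id _
  | assoc => exact Category.assoc _ _ _
  | tensor_id => exact id_tensorHom_id _ _
  | tensor_comp => exact tensorHom_comp_tensorHom _ _ _ _
  | assoc_hom_inv A B D => exact (inclIso (α_ A B D)).hom_inv_id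
  | assoc_inv_hom A B D => exact (inclIso (α_ A B D)).inv_hom_id
  | assoc_naturality => exact associator_naturality _ _ _
  | left_hom_inv A => exact (inclIso (λ_ A)).hom_inv_id
  | left_inv_hom A => exact (inclIso (λ_ A)).inv_hom_id
  | left_naturality =>
    exact (congrArg (· ≫ _) (id_tensorHom _ _)).trans (leftUnitor_naturality _)
  | right_hom_inv A => exact (inclIso (ρ_ A)).hom_inv_id
  | right_inv_hom A => exact (inclIso (ρ_ A)).inv_hom_id
  | right_naturality =>
    exact (congrArg (· ≫ _) (tensorHom_id _ _)).trans (rightUnitor_naturality _)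
  | pentagon A B D E => exact pentagon_tensorHom (D := EnvCat C) ⟨A⟩ ⟨B⟩ ⟨D⟩ ⟨E⟩
  | triangle A B => exact triangle_tensorHom (D := EnvCat C) ⟨A⟩ ⟨B⟩
  | braid_naturality => exact BraidedCategory.braiding_naturality _ _
  | hexagon A B D => exact hexagon_tensorHom (D := EnvCat C) ⟨A⟩ ⟨B⟩ ⟨D⟩
  | symmetry A B => exact SymmetricCategory.symmetry (C := EnvCat C) ⟨A⟩ ⟨B⟩

/-- The interpretation of the discard construction. -/
def ofDiscard {A B : C} :
    ((Discard.ofC.obj A : Discard C) ⟶ Discard.ofC.obj B) → ((⟨A⟩ : EnvCat C) ⟶ ⟨B⟩) :=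
  Quotient.lift evalDiscard fun _ _ ↦ evalDiscard_eq

/-- No information about the class of `f` is lost in the discard construction: discarding `X` in the
model only moves it into the environment. -/
theorem ofDiscard_discardEnv {A B X : C} (f : A ⟶ B ⊗ X) :
    ofDiscard (Discard.discardEnv f) = homMk f := by
  have h : ofDiscard (Discard.discardEnv f) =
      incl f ≫ (𝟙 (⟨B⟩ : EnvCat C) ⊗ₘ discard X) ≫ incl (ρ_ B).hom := rfl
  rw [h, id_tensorHom]
  change incl f ≫ whiskerLeftHom B (homMk (B := 𝟙_ C) (λ_ X).inv) ≫ incl (ρ_ B).hom = _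
  rw [whiskerLeftHom_homMk, homMk_comp_incl, incl_comp_homMk]
  congr 1
  monoidal

end EnvCat

/-! ### Discarding identifies related morphisms -/

namespace Discard

/-- This is the use of the pushout: `u` is replaced by its copy in the affine completion, where `!`
is natural. -/
theorem map_comp_ground {X Z : C} (u : X ⟶ Z) (hu : isometries C u) :
    ofC.map u ≫ ground Z = ground X := by
  let u' : (⟨X⟩ : IsoCat C) ⟶ ⟨Z⟩ := ⟨u, hu⟩
  have h : ofC.map u = ofAff.map (Affine.incl.map u') := Quotient.sound (.rel (.glue u'))
  rw [h, ground, ground, ← Affine.comp_bang (Affine.incl.map u')]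
  exact (ofAff.map_comp _ _).symm

theorem map_whiskerLeft (B : C) {X Z : C} (u : X ⟶ Z) :
    ofC.map (B ◁ u) = ofC.obj B ◁ ofC.map u := by
  have h : ofC.map (𝟙 B ⊗ₘ u) = ofC.map (𝟙 B) ⊗ₘ ofC.map u :=
    Quotient.sound (.rel (.ofC_tensor _ _))
  rw [← id_tensorHom, h, ofC.map_id, id_tensorHom]

theorem map_whiskerLeft_comp_discardRight (B : C) {X Z : C} (u : X ⟶ Z)
    (hu : isometries C u) : ofC.map (B ◁ u) ≫ discardRight B Z = discardRight B X := by
  rw [map_whiskerLeft, discardRight, discardRight, ← map_comp_ground u hu, whiskerLeft_comp]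
  exact (Category.assoc _ _ _).symm

theorem discardEnv_eq_of_isoRel {A B : C} {p q : Σ X : C, A ⟶ B ⊗ X} (h : IsoRel p q) :
    discardEnv p.2 = discardEnv q.2 := by
  obtain ⟨Z, a, b, ha, hb, h⟩ := h
  rw [discardEnv, discardEnv, ← map_whiskerLeft_comp_discardRight B a ha,
    ← map_whiskerLeft_comp_discardRight B b hb, ← Category.assoc, ← Category.assoc,
    ← ofC.map_comp, ← ofC.map_comp, h]

theorem discardEnv_eq_of_transGen {A B : C} {p q : Σ X : C, A ⟶ B ⊗ X}
    (h : Relation.TransGen IsoRel p q) : discardEnv p.2 = discardEnv q.2 := by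
  induction h with
  | single h => exact discardEnv_eq_of_isoRel h
  | tail _ h ih => exact ih.trans (discardEnv_eq_of_isoRel h)

theorem transGen_of_discardEnv_eq {A B X Y : C} {f : A ⟶ B ⊗ X} {g : A ⟶ B ⊗ Y}
    (h : discardEnv f = discardEnv g) : Relation.TransGen IsoRel ⟨X, f⟩ ⟨Y, g⟩ := by
  rw [← EnvCat.homMk_eq_iff, ← EnvCat.ofDiscard_discardEnv, h, EnvCat.ofDiscard_discardEnv]

end Discard

end DiscardConstruction

theorem mainTheorem4 {C : Type u} [Category.{v} C] [MonoidalCategory C] [SymmetricCategory C]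
    [DaggerSymmetricCategory C] {A B X Y : C} (f : A ⟶ B ⊗ X) (g : A ⟶ B ⊗ Y) :
    (Relation.TransGen IsoRel ⟨X, f⟩ ⟨Y, g⟩ ↔ Discard.discardEnv f = Discard.discardEnv g) ∧
    (∀ h : (Discard.ofC.obj A : Discard C) ⟶ Discard.ofC.obj B,
      Discard.IsPurification f h → Discard.IsPurification g h →
        Relation.TransGen IsoRel ⟨X, f⟩ ⟨Y, g⟩) :=
  ⟨⟨Discard.discardEnv_eq_of_transGen, Discard.transGen_of_discardEnv_eq⟩,
    fun _ hf hg ↦ Discard.transGen_of_discardEnv_eq (hf.symm.trans hg)⟩
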